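/- Let $\mathfrak{A}$ be any C*-algebra (not necessarily unital), with dual $\mathfrak{A}^*$ and bidual $\mathfrak{A}^{**}$, the latter being a W*-algebra with predual $\mathfrak{A}^*$ under the bidual norm, the Arens product and the involution $F^*(\varphi)=\overline{F(\varphi^*)}$, where $\varphi^*(a)=\overline{\varphi(a^*)}$. For a C*-algebra $\mathfrak{B}$ let $\mathcal{S}(\mathfrak{B})$ be the set of its states, i.e. of the bounded linear functionals $\omega$ on $\mathfrak{B}$ with $\omega(b^*b)\geq 0$ for all $b\in\mathfrak{B}$ and $\|\omega\|=1$. A state $\Phi$ on $\mathfrak{A}^{**}$ is normal if there is $\varphi\in\mathfrak{A}^*$ with $\Phi(F)=F(\varphi)$ for all $F\in\mathfrak{A}^{**}$. For $\omega\in\mathfrak{A}^*$ let $\hat\omega$ be the functional $F\mapsto F(\omega)$ on $\mathfrak{A}^{**}$. Then $\{\hat\omega : \omega\in\mathcal{S}(\mathfrak{A})\}$ is exactly the set of normal states on $\mathfrak{A}^{**}$, and it is dense in $\mathcal{S}(\mathfrak{A}^{**})$ in the weak* topology, i.e. the topology of pointwise convergence on $\mathfrak{A}^{**}$. -/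

import Mathlib

open scoped ComplexOrder

noncomputable section

/-- The state space of an algebra `B` carrying a product, an involution and a norm (for instance a
C⋆-algebra): the continuous linear functionals that are positive and of norm one. It is a subset of
`WeakDual ℂ B`, that is, of the dual of `B` with the weak* topology (pointwise convergence
on `B`). -/
def stateSpace (B : Type*) [NormedAddCommGroup B] [NormedSpace ℂ B] [Mul B] [Star B] :
    Set (WeakDual ℂ B) :=
  {ω | (∀ b : B, 0 ≤ ω (star b * b)) ∧ ‖WeakDual.toStrongDual ω‖ = 1}

/-- The bidual `A**`, the normed space of bounded linear functionals on the dual of `A`.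
Its product and involution are given below. -/
def Bidual (A : Type*) [NonUnitalCStarAlgebra A] : Type _ :=
  StrongDual ℂ (StrongDual ℂ A)

namespace Bidual

variable {A : Type*} [NonUnitalCStarAlgebra A]

instance instNormedAddCommGroup : NormedAddCommGroup (Bidual A) :=
  inferInstanceAs (NormedAddCommGroup (StrongDual ℂ (StrongDual ℂ A)))

instance instNormedSpace : NormedSpace ℂ (Bidual A) :=
  inferInstanceAs (NormedSpace ℂ (StrongDual ℂ (StrongDual ℂ A)))

/-- An element of `A**`, as a functional on the dual of `A`. -/
def toFunctional : Bidual A ≃ₗᵢ[ℂ] StrongDual ℂ (StrongDual ℂ A) :=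
  LinearIsometryEquiv.refl ℂ _

/-- The canonical embedding of `A` into `A**`, `a ↦ (φ ↦ φ a)`. -/
def incl (a : A) : Bidual A :=
  toFunctional.symm (NormedSpace.inclusionInDoubleDual ℂ A a)

/-- For `φ` in the dual of `A`, the map `a ↦ (b ↦ φ (a * b))` from `A` to its dual, as a
continuous linear function of `φ`. -/
def dualMul : StrongDual ℂ A →L[ℂ] A →L[ℂ] StrongDual ℂ A :=
  ((ContinuousLinearMap.compL ℂ A (A →L[ℂ] A) (StrongDual ℂ A)).flip
    (ContinuousLinearMap.mul ℂ A)).comp (ContinuousLinearMap.compL ℂ A A ℂ)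

@[simp]
theorem dualMul_apply (φ : StrongDual ℂ A) (a b : A) : dualMul φ a b = φ (a * b) := rfl

/-- The action of `G` in `A**` on the dual of `A`: `(G · φ) a = G (b ↦ φ (a * b))`. -/
def act (G : Bidual A) : StrongDual ℂ A →L[ℂ] StrongDual ℂ A :=
  (ContinuousLinearMap.compL ℂ A (StrongDual ℂ A) ℂ (toFunctional G)).comp dualMul

@[simp]
theorem act_apply (G : Bidual A) (φ : StrongDual ℂ A) (a : A) :
    act G φ a = toFunctional G (dualMul φ a) := rfl

/-- The (Arens) product of the bidual: `(F * G) φ = F (G · φ)`. -/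
instance instMul : Mul (Bidual A) :=
  ⟨fun F G => toFunctional.symm ((toFunctional F).comp (act G))⟩

@[simp]
theorem mul_apply (F G : Bidual A) (φ : StrongDual ℂ A) :
    toFunctional (F * G) φ = toFunctional F (act G φ) := rfl

/-- The involution of the dual of `A`: `φ⋆ a = conj (φ (a⋆))`. -/
def dualStar : StrongDual ℂ A →L⋆[ℂ] StrongDual ℂ A :=
  LinearMap.mkContinuous
    { toFun := fun φ =>
        ((starL ℂ : ℂ ≃L⋆[ℂ] ℂ) : ℂ →L⋆[ℂ] ℂ).comp
          (φ.comp ((starL ℂ : A ≃L⋆[ℂ] A) : A →L⋆[ℂ] A))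
      map_add' := fun φ ψ => by ext a; simp
      map_smul' := fun c φ => by ext a; simp } 1
    (fun φ => by
      refine ContinuousLinearMap.opNorm_le_bound _ (by positivity) fun a => ?_
      simpa using φ.le_opNorm (star a))

@[simp]
theorem dualStar_apply (φ : StrongDual ℂ A) (a : A) : dualStar φ a = star (φ (star a)) := rfl

/-- The involution of the bidual: `F⋆ φ = conj (F (φ⋆))`. -/
instance instStar : Star (Bidual A) :=
  ⟨fun F => toFunctional.symm
    (((starL ℂ : ℂ ≃L⋆[ℂ] ℂ) : ℂ →L⋆[ℂ] ℂ).comp ((toFunctional F).comp dualStar))⟩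

@[simp]
theorem star_apply (F : Bidual A) (φ : StrongDual ℂ A) :
    toFunctional (star F) φ = star (toFunctional F (dualStar φ)) := rfl

/-- A functional on `A`, regarded as a functional on `A**` by evaluation: `F ↦ F φ`. -/
def evalAt (φ : WeakDual ℂ A) : WeakDual ℂ (Bidual A) :=
  StrongDual.toWeakDual
    ((NormedSpace.inclusionInDoubleDual ℂ (StrongDual ℂ A) (WeakDual.toStrongDual φ)).comp
      ((toFunctional (A := A)).toContinuousLinearEquiv : Bidual A →L[ℂ] StrongDual ℂ (StrongDual ℂ A)))

@[simp]
theorem evalAt_apply (φ : WeakDual ℂ A) (F : Bidual A) :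
    evalAt φ F = toFunctional F (WeakDual.toStrongDual φ) := rfl

end Bidual

/-- The normal states of the W⋆-algebra `A**`: the states given by evaluation at an element of the
predual of `A**`, which is the dual of `A`. -/
def normalStateSpace (A : Type*) [NonUnitalCStarAlgebra A] : Set (WeakDual ℂ (Bidual A)) :=
  {Φ | Φ ∈ stateSpace (Bidual A) ∧
    ∃ φ : StrongDual ℂ A, ∀ F : Bidual A, Φ F = Bidual.toFunctional F φ}

end

open scoped ComplexOrder InnerProductSpace Topology
open Filter

noncomputable section

universe u

/-! Everything is read off from positive functionals on `A`; the C⋆-identity of the bidual is never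
used. For positive `ω` with GNS map `T : A → H`, each `F` in the bidual yields a vector `η F` by
Riesz, and `(star F * G) ω = ⟪η F, η G⟫` (`exists_vector_star_mul`). So evaluation at `ω` is
positive.

Hahn-Banach gives a Jordan decomposition of hermitian functionals, so the norm of a hermitian
element of the bidual is controlled by its values on quasi-states (`norm_le_of_quasiState`). Hence
`star F * G = star (star G * F)`, and a weak* limit `e` of an approximate unit is a self-adjoint
unit at which every positive functional takes its norm (`apply_unit_eq_norm`).

For density, Hahn-Banach reduces the claim to `re_apply_le_of_forall_state`: a bound `Re F ≤ u` on
states of `A` must pass to every state of the bidual. For small `s > 0` the hermitian element `K = e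
+ s Re F` has values in `[0, 1 + s u]` on quasi-states, so `‖K‖ ≤ 1 + s u`. A state `Φ` then
satisfies `1 + s Re Φ(F) = Φ(K) ≤ 1 + s u`. -/

/-- A positive functional on a non-unital C⋆-algebra is implemented by a bounded linear map into a
Hilbert space. -/
theorem exists_gns_map {A : Type u} [NonUnitalCStarAlgebra A] (ω : StrongDual ℂ A)
    (hω : ∀ a, 0 ≤ ω (star a * a)) :
    ∃ (H : Type u) (_ : NormedAddCommGroup H) (_ : InnerProductSpace ℂ H) (_ : CompleteSpace H)
      (T : A →L[ℂ] H), ∀ a b, ω (star a * b) = ⟪T a, T b⟫_ℂ := by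
  let _ := CStarAlgebra.spectralOrder A
  have := CStarAlgebra.spectralOrderedRing A
  let f : A →ₚ[ℂ] ℂ := PositiveLinearMap.mk₀ ω.toLinearMap fun x hx => by
    obtain ⟨b, rfl⟩ := CStarAlgebra.nonneg_iff_eq_star_mul_self.mp hx
    exact hω b
  let T₀ : A →L[ℂ] f.PreGNS := f.toPreGNS.toLinearMap.mkContinuous (√‖ω‖) fun a => by
    rw [LinearEquiv.coe_coe, f.preGNS_norm_def, f.ofPreGNS_toPreGNS]
    refine Real.sqrt_le_iff.mpr ⟨by positivity, ?_⟩
    rw [mul_pow, Real.sq_sqrt (norm_nonneg ω), sq, ← CStarRing.norm_star_mul_self]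
    exact (Complex.re_le_norm _).trans (ω.le_opNorm _)
  refine ⟨f.GNS, inferInstance, inferInstance, inferInstance,
    (UniformSpace.Completion.toComplL (𝕜 := ℂ) (E := f.PreGNS)).comp T₀, fun a b => ?_⟩
  simp only [ContinuousLinearMap.comp_apply, UniformSpace.Completion.coe_toComplL,
    UniformSpace.Completion.inner_coe]
  rfl

/-- A bounded functional on the dual of `A` is represented, along a bounded linear map from `A`
into a Hilbert space, by a vector. -/
theorem exists_vector_of_bidual {A H : Type*} [NormedAddCommGroup A] [NormedSpace ℂ A]
    [NormedAddCommGroup H] [InnerProductSpace ℂ H] [CompleteSpace H] (T : A →L[ℂ] H)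
    (F : StrongDual ℂ (StrongDual ℂ A)) :
    ∃ η : H, ∀ ξ : H, F ((innerSL ℂ ξ).comp T) = ⟪ξ, η⟫_ℂ := by
  let S : H →L⋆[ℂ] StrongDual ℂ A :=
    ((ContinuousLinearMap.compL ℂ A H ℂ).flip T).comp (innerSL ℂ)
  -- `F.comp S` is conjugate-linear; conjugating it makes Riesz applicable.
  let L : StrongDual ℂ H := ((starL ℂ : ℂ ≃L⋆[ℂ] ℂ) : ℂ →L⋆[ℂ] ℂ).comp (F.comp S)
  refine ⟨(InnerProductSpace.toDual ℂ H).symm L, fun ξ => ?_⟩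
  rw [← inner_conj_symm, InnerProductSpace.toDual_symm_apply]
  exact (star_star _).symm

/-! ### The Arens product: Gram form, right unit, norm bounds -/

namespace Bidual

variable {A : Type*} [NonUnitalCStarAlgebra A]

/-- At a positive functional, the Arens product is the inner product of representing vectors. -/
theorem exists_vector_star_mul {A : Type u} [NonUnitalCStarAlgebra A] (ω : StrongDual ℂ A) (hω : ∀ a, 0 ≤ ω (star a * a)) :
    ∃ (H : Type u) (_ : NormedAddCommGroup H) (_ : InnerProductSpace ℂ H) (η : Bidual A → H),
      ∀ F G : Bidual A, toFunctional (star F * G) ω = ⟪η F, η G⟫_ℂ := by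
  obtain ⟨H, _, _, _, T, hT⟩ := exists_gns_map ω hω
  choose η hη using fun F : Bidual A => exists_vector_of_bidual T (toFunctional F)
  refine ⟨H, inferInstance, inferInstance, η, fun F G => ?_⟩
  have hG : ∀ a : A, toFunctional G (dualMul ω a) = ⟪T (star a), η G⟫_ℂ := fun a => by
    rw [← hη]
    congr 1
    ext b
    simp [← hT]
  have hF : dualStar (act G ω) = (innerSL ℂ (η G)).comp T := by
    ext a
    simp [hG]
  rw [mul_apply, star_apply, hF, hη]
  exact inner_conj_symm _ _

theorem star_mul_self_nonneg_of_positive (ω : StrongDual ℂ A) (hω : ∀ a, 0 ≤ ω (star a * a))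
    (F : Bidual A) : 0 ≤ toFunctional (star F * F) ω := by
  obtain ⟨H, _, _, η, hη⟩ := exists_vector_star_mul ω hω
  rw [hη, inner_self_eq_norm_sq_to_K]
  exact Complex.zero_le_real.mpr (sq_nonneg ‖η F‖) |>.trans_eq (by simp)

theorem star_mul_conj_symm_of_positive (ω : StrongDual ℂ A) (hω : ∀ a, 0 ≤ ω (star a * a))
    (F G : Bidual A) :
    toFunctional (star F * G) ω = star (toFunctional (star G * F) ω) := by
  obtain ⟨H, _, _, η, hη⟩ := exists_vector_star_mul ω hω
  rw [hη, hη]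
  exact (inner_conj_symm _ _).symm

/-- The Arens product has a right unit in the unit ball. -/
theorem exists_right_unit (A : Type*) [NonUnitalCStarAlgebra A] :
    ∃ e : Bidual A, ‖e‖ ≤ 1 ∧ ∀ F : Bidual A, F * e = F := by
  let _ := CStarAlgebra.spectralOrder A
  have := CStarAlgebra.spectralOrderedRing A
  have hl := CStarAlgebra.increasingApproximateUnit A
  -- Refining to an ultrafilter turns weak* compactness of the ball into actual convergence.
  let U : Ultrafilter A := Ultrafilter.of (CStarAlgebra.approximateUnit A)
  have hU : (U : Filter A) ≤ CStarAlgebra.approximateUnit A := Ultrafilter.of_le _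
  let j : A → WeakDual ℂ (StrongDual ℂ A) := fun a =>
    StrongDual.toWeakDual (NormedSpace.inclusionInDoubleDual ℂ A a)
  have hK := WeakDual.isCompact_closedBall (𝕜 := ℂ) (E := StrongDual ℂ A) 0 1
  obtain ⟨e, he, hle⟩ := hK.ultrafilter_le_nhds (U.map j) (by
    rw [le_principal_iff]
    refine hU (hl.eventually_norm.mono fun a ha => ?_)
    simpa [j] using (NormedSpace.double_dual_bound ℂ A a).trans ha)
  refine ⟨toFunctional.symm (WeakDual.toStrongDual e), (by simpa using he : ‖WeakDual.toStrongDual e‖ ≤ 1), fun F => ?_⟩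
  have hact : ∀ φ, act (toFunctional.symm (WeakDual.toStrongDual e)) φ = φ := fun φ => by
    ext a
    have h1 : Tendsto (fun x => j x (dualMul φ a)) U (𝓝 (e (dualMul φ a))) :=
      ((WeakDual.eval_continuous _).tendsto e).comp hle
    have h2 : Tendsto (fun x => j x (dualMul φ a)) U (𝓝 (φ a)) :=
      ((φ.continuous.tendsto a).comp (hl.tendsto_mul_left a)).mono_left hU
    exact tendsto_nhds_unique h1 h2
  refine toFunctional.injective (ContinuousLinearMap.ext fun φ => ?_)
  rw [mul_apply, hact]

theorem norm_toFunctional (F : Bidual A) : ‖toFunctional F‖ = ‖F‖ :=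
  toFunctional.norm_map F

theorem norm_act_le (G : Bidual A) (φ : StrongDual ℂ A) : ‖act G φ‖ ≤ ‖G‖ * ‖φ‖ := by
  refine ContinuousLinearMap.opNorm_le_bound _ (by positivity) fun a => ?_
  have h : ‖dualMul φ a‖ ≤ ‖φ‖ * ‖a‖ :=
    ContinuousLinearMap.opNorm_le_bound _ (by positivity) fun b => by
      rw [dualMul_apply, mul_assoc]
      exact (φ.le_opNorm _).trans (by gcongr; exact norm_mul_le a b)
  rw [act_apply, mul_assoc]
  refine ((toFunctional G).le_opNorm _).trans ?_
  rw [norm_toFunctional]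
  gcongr

theorem norm_mul_le (F G : Bidual A) : ‖F * G‖ ≤ ‖F‖ * ‖G‖ := by
  rw [← norm_toFunctional]
  refine ContinuousLinearMap.opNorm_le_bound _ (by positivity) fun φ => ?_
  rw [mul_apply, mul_assoc]
  refine ((toFunctional F).le_opNorm _).trans ?_
  rw [norm_toFunctional]
  gcongr
  exact norm_act_le G φ

theorem norm_dualStar_le (φ : StrongDual ℂ A) : ‖dualStar φ‖ ≤ ‖φ‖ :=
  ContinuousLinearMap.opNorm_le_bound _ (by positivity) fun a => by
    simpa using φ.le_opNorm (star a)

theorem norm_star_le (F : Bidual A) : ‖star F‖ ≤ ‖F‖ := by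
  rw [← norm_toFunctional]
  refine ContinuousLinearMap.opNorm_le_bound _ (by positivity) fun φ => ?_
  rw [star_apply, norm_star]
  refine ((toFunctional F).le_opNorm _).trans ?_
  rw [norm_toFunctional]
  gcongr
  exact norm_dualStar_le φ

theorem dualStar_dualStar (φ : StrongDual ℂ A) : dualStar (dualStar φ) = φ := by
  ext a
  simp

theorem ext_functional {F G : Bidual A} (h : ∀ φ, toFunctional F φ = toFunctional G φ) : F = G :=
  toFunctional.injective (ContinuousLinearMap.ext h)

theorem star_star (F : Bidual A) : star (star F) = F :=
  ext_functional fun φ => by simp [dualStar_dualStar]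

theorem star_add (F G : Bidual A) : star (F + G) = star F + star G :=
  ext_functional fun φ => by simp

theorem star_smul (c : ℂ) (F : Bidual A) : star (c • F) = star c • star F :=
  ext_functional fun φ => by simp

theorem add_mul (F G K : Bidual A) : (F + G) * K = F * K + G * K :=
  ext_functional fun φ => by simp

theorem smul_mul (c : ℂ) (F G : Bidual A) : (c • F) * G = c • (F * G) :=
  ext_functional fun φ => by simp

theorem act_add (G K : Bidual A) (φ : StrongDual ℂ A) : act (G + K) φ = act G φ + act K φ := by
  ext a
  simp

theorem act_smul (c : ℂ) (G : Bidual A) (φ : StrongDual ℂ A) : act (c • G) φ = c • act G φ := by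
  ext a
  simp

theorem mul_add (F G K : Bidual A) : F * (G + K) = F * G + F * K :=
  ext_functional fun φ => by simp [act_add]

theorem mul_smul (c : ℂ) (F G : Bidual A) : F * (c • G) = c • (F * G) :=
  ext_functional fun φ => by simp [act_smul]

end Bidual

/-! ### Contractive unital functionals -/

/-- A contractive unital functional on a unital C⋆-algebra is real on self-adjoint elements. -/
theorem im_eq_zero_of_unital_contraction {U : Type*} [CStarAlgebra U] (g : StrongDual ℂ U)
    (hg : ‖g‖ ≤ 1) (h1 : g 1 = 1) {a : U} (ha : IsSelfAdjoint a) : (g a).im = 0 := by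
  -- Compare `|g (a + it)|` with `‖a + it‖`: the `t ^ 2` terms cancel, leaving a bound on `2 t Im (g
  -- a)` uniform in `t`.
  have key : ∀ t : ℝ, ((g a).im + t) ^ 2 ≤ ‖a‖ ^ 2 + t ^ 2 := fun t => by
    have hstar : star (a + (t * Complex.I) • (1 : U)) * (a + (t * Complex.I) • (1 : U)) =
        a * a + ((t : ℂ) ^ 2) • (1 : U) := by
      rw [star_add, star_smul, star_one, ha.star_eq]
      simp only [add_mul, mul_add, smul_mul_assoc, mul_smul_comm, one_mul, mul_one, smul_add]
      have h2 : star ((t : ℂ) * Complex.I) = -(t * Complex.I) := by simp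
      have h3 : (t * Complex.I) * -(t * Complex.I) = ((t : ℂ) ^ 2) := by
        linear_combination (-(t : ℂ) ^ 2) * Complex.I_sq
      rw [h2, smul_smul, h3, neg_smul]
      abel
    have hnorm : ‖a + (t * Complex.I) • (1 : U)‖ ^ 2 ≤ ‖a‖ ^ 2 + t ^ 2 := by
      rw [sq, ← CStarRing.norm_star_mul_self, hstar]
      refine (norm_add_le _ _).trans (add_le_add ?_ ?_)
      · rw [sq]
        exact norm_mul_le a a
      · rw [norm_smul]
        have : ‖(1 : U)‖ ≤ 1 := by
          rcases subsingleton_or_nontrivial U with h | h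
          · simp [Subsingleton.elim (1 : U) 0]
          · simp
        calc ‖((t : ℂ) ^ 2)‖ * ‖(1 : U)‖ ≤ ‖((t : ℂ) ^ 2)‖ * 1 := by gcongr
          _ = t ^ 2 := by simp
    have hval : (g (a + (t * Complex.I) • (1 : U))).im = (g a).im + t := by
      simp [h1]
    calc ((g a).im + t) ^ 2 = |(g (a + (t * Complex.I) • (1 : U))).im| ^ 2 := by
          rw [hval, sq_abs]
      _ ≤ ‖g (a + (t * Complex.I) • (1 : U))‖ ^ 2 := by
          gcongr
          exact Complex.abs_im_le_norm _
      _ ≤ ‖a + (t * Complex.I) • (1 : U)‖ ^ 2 := by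
          gcongr
          exact (g.le_opNorm _).trans (mul_le_of_le_one_left (norm_nonneg _) hg)
      _ ≤ _ := hnorm
  by_contra hne
  have h2 := key (‖a‖ ^ 2 / (g a).im)
  have h3 : (g a).im * (‖a‖ ^ 2 / (g a).im) = ‖a‖ ^ 2 := by field_simp
  nlinarith [sq_nonneg ‖a‖, sq_pos_of_ne_zero hne]

/-- A contractive unital functional on a unital C⋆-algebra is positive. -/
theorem positive_of_unital_contraction {U : Type*} [CStarAlgebra U] (g : StrongDual ℂ U)
    (hg : ‖g‖ ≤ 1) (h1 : g 1 = 1) (b : U) : 0 ≤ g (star b * b) := by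
  let _ := CStarAlgebra.spectralOrder U
  have := CStarAlgebra.spectralOrderedRing U
  set a := star b * b with ha
  have hsa : IsSelfAdjoint a := IsSelfAdjoint.star_mul_self b
  have ha0 : 0 ≤ a := star_mul_self_nonneg b
  -- Since `0 ≤ a ≤ ‖a‖`; applying `g` then gives `‖a‖ - Re (g a) ≤ ‖a‖`.
  have hle : ‖algebraMap ℝ U ‖a‖ - a‖ ≤ ‖a‖ := by
    rw [CStarAlgebra.norm_le_iff_le_algebraMap _ (norm_nonneg a)
      (sub_nonneg.mpr hsa.le_algebraMap_norm_self)]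
    simpa using ha0
  rw [Complex.nonneg_iff]
  refine ⟨?_, (im_eq_zero_of_unital_contraction g hg h1 hsa).symm⟩
  have hval : (g (algebraMap ℝ U ‖a‖ - a)).re = ‖a‖ - (g a).re := by
    rw [IsScalarTower.algebraMap_apply ℝ ℂ U, Algebra.algebraMap_eq_smul_one]
    simp [h1]
  have hb : (g (algebraMap ℝ U ‖a‖ - a)).re ≤ ‖a‖ :=
    (Complex.re_le_norm _).trans <| (g.le_opNorm _).trans <|
      (mul_le_of_le_one_left (norm_nonneg _) hg).trans hle
  linarith

/-- A norming functional of `h + ‖h‖` works: this element has norm at least `2‖h‖`, which forces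
both `g h = ‖h‖` and `g 1 = 1`, hence positivity. -/
theorem exists_positive_apply_eq_norm_of_mem_spectrum {U : Type*} [CStarAlgebra U] {h : U}
    (hspec : ‖h‖ ∈ spectrum ℝ h) :
    ∃ g : StrongDual ℂ U, (∀ b, 0 ≤ g (star b * b)) ∧ ‖g‖ ≤ 1 ∧ g h = ‖h‖ := by
  rcases eq_or_ne h 0 with rfl | hne
  · exact ⟨0, fun _ => le_rfl, by simp, by simp⟩
  have : Nontrivial U := ⟨h, 0, hne⟩
  have hpos : 0 < ‖h‖ := norm_pos_iff.mpr hne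
  obtain ⟨g, hg, hgx⟩ := exists_dual_vector'' ℂ (h + algebraMap ℝ U ‖h‖)
  have hx : ‖h‖ + ‖h‖ ≤ ‖h + algebraMap ℝ U ‖h‖‖ :=
    (Real.le_norm_self _).trans <|
      spectrum.norm_le_norm_of_mem <| by
        rw [add_comm h]
        exact spectrum.add_mem_add_iff.mpr hspec
  have hsum : g h + ‖h‖ * g 1 = (‖h + algebraMap ℝ U ‖h‖‖ : ℂ) := by
    refine Eq.trans ?_ hgx
    rw [map_add, IsScalarTower.algebraMap_apply ℝ ℂ U, Algebra.algebraMap_eq_smul_one]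
    simp
  have hgh : ‖g h‖ ≤ ‖h‖ := (g.le_opNorm _).trans (mul_le_of_le_one_left (norm_nonneg _) hg)
  have hg1 : ‖g 1‖ ≤ 1 := (g.le_opNorm _).trans (by simpa using hg)
  have hre : (g h).re + ‖h‖ * (g 1).re = ‖h + algebraMap ℝ U ‖h‖‖ := by
    simpa using congrArg Complex.re hsum
  have hre1 : (g 1).re ≤ 1 := (Complex.re_le_norm _).trans hg1
  have hreh : (g h).re ≤ ‖h‖ := (Complex.re_le_norm _).trans hgh
  have eq1 : (g 1).re = 1 := le_antisymm hre1 (by nlinarith)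
  have eqh : (g h).re = ‖h‖ := le_antisymm hreh (by nlinarith)
  have key : ∀ z : ℂ, ‖z‖ ≤ z.re → z = (z.re : ℂ) := fun z hz => by
    have := Complex.re_eq_norm.mp (le_antisymm (Complex.re_le_norm z) hz)
    exact Complex.eq_re_of_ofReal_le this
  have h1 : g 1 = 1 := by rw [key (g 1) (by rwa [eq1]), eq1]; simp
  exact ⟨g, positive_of_unital_contraction g hg h1, hg, by rw [key (g h) (by rwa [eqh]), eqh]⟩

/-! ### Quasi-states and the Jordan decomposition -/

/-- The quasi-state space of a C⋆-algebra: the positive functionals of norm at most one. -/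
def quasiStateSpace (A : Type*) [NonUnitalCStarAlgebra A] : Set (WeakDual ℂ A) :=
  {ω | (∀ a : A, 0 ≤ ω (star a * a)) ∧ ‖WeakDual.toStrongDual ω‖ ≤ 1}

variable {A : Type*} [NonUnitalCStarAlgebra A]

/-- The norm of a self-adjoint element is attained on a quasi-state. -/
theorem exists_quasiState_norm_apply_eq {h : A} (hh : IsSelfAdjoint h) :
    ∃ ω ∈ quasiStateSpace A, ‖ω h‖ = ‖h‖ := by
  let ι : A →L[ℂ] Unitization ℂ A :=
    (Unitization.inrNonUnitalAlgHom ℂ A : A →ₗ[ℂ] Unitization ℂ A).mkContinuous 1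
      fun a => by simp [Unitization.norm_inr]
  have hn : ‖(h : Unitization ℂ A)‖ = ‖h‖ := Unitization.norm_inr h
  have hs : IsSelfAdjoint (h : Unitization ℂ A) := hh.inr ℂ
  obtain ⟨g, hg0, hg1, hgh⟩ : ∃ g : StrongDual ℂ (Unitization ℂ A),
      (∀ b, 0 ≤ g (star b * b)) ∧ ‖g‖ ≤ 1 ∧ ‖g (h : Unitization ℂ A)‖ = ‖h‖ := by
    rcases CStarAlgebra.norm_or_neg_norm_mem_spectrum hs with hm | hm
    · obtain ⟨g, h0, h1, h2⟩ := exists_positive_apply_eq_norm_of_mem_spectrum hm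
      exact ⟨g, h0, h1, by rw [h2, hn]; simp⟩
    · obtain ⟨g, h0, h1, h2⟩ := exists_positive_apply_eq_norm_of_mem_spectrum
        (h := -(h : Unitization ℂ A)) (by
          rw [norm_neg, ← spectrum.neg_eq]; simpa using hm)
      exact ⟨g, h0, h1, by rw [← norm_neg, ← map_neg, h2, norm_neg, hn]; simp⟩
  refine ⟨StrongDual.toWeakDual (g.comp ι), ⟨fun a => ?_, ?_⟩, hgh⟩
  · have : ι (star a * a) = star (a : Unitization ℂ A) * (a : Unitization ℂ A) := by simp [ι]
    exact (hg0 _).trans_eq (congrArg g this.symm)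
  · have hι : ‖ι‖ ≤ 1 := LinearMap.mkContinuous_norm_le _ zero_le_one _
    exact (g.opNorm_comp_le ι).trans (mul_le_one₀ hg1 (norm_nonneg _) hι)

theorem map_star_of_positive (ω : StrongDual ℂ A) (hω : ∀ a, 0 ≤ ω (star a * a)) (a : A) :
    ω (star a) = star (ω a) := by
  let _ := CStarAlgebra.spectralOrder A
  have := CStarAlgebra.spectralOrderedRing A
  let f : A →ₚ[ℂ] ℂ := PositiveLinearMap.mk₀ ω.toLinearMap fun x hx => by
    obtain ⟨b, rfl⟩ := CStarAlgebra.nonneg_iff_eq_star_mul_self.mp hx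
    exact hω b
  exact map_star f a

theorem convex_quasiStateSpace : Convex ℝ (quasiStateSpace A) := by
  rintro x ⟨hx, hx1⟩ y ⟨hy, hy1⟩ s t hs ht hst
  refine ⟨fun a => ?_, ?_⟩
  · have h : (s • x + t • y) (star a * a) = (s : ℂ) * x (star a * a) + t * y (star a * a) := rfl
    rw [h]
    exact add_nonneg (mul_nonneg (by exact_mod_cast hs) (hx a))
      (mul_nonneg (by exact_mod_cast ht) (hy a))
  · have h := convex_closedBall (0 : StrongDual ℂ A) 1 (mem_closedBall_zero_iff.mpr hx1)
      (mem_closedBall_zero_iff.mpr hy1) hs ht hst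
    exact mem_closedBall_zero_iff.mp h

theorem isCompact_quasiStateSpace : IsCompact (quasiStateSpace A) := by
  have hK := WeakDual.isCompact_closedBall (𝕜 := ℂ) (E := A) 0 1
  have hC : IsClosed {ω : WeakDual ℂ A | ∀ a : A, 0 ≤ ω (star a * a)} := by
    rw [Set.ofPred_forall]
    exact isClosed_iInter fun a => isClosed_Ici.preimage (WeakDual.eval_continuous _)
  convert hK.inter_left hC using 1
  ext ω
  simp [quasiStateSpace]

theorem zero_mem_quasiStateSpace : (0 : WeakDual ℂ A) ∈ quasiStateSpace A :=
  ⟨fun _ => le_rfl, by simp⟩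

/-- Points are separated from weak* closed convex sets by elements of the predual. -/
theorem exists_re_lt_of_notMem_closed_convex {E : Type*} [NormedAddCommGroup E] [NormedSpace ℂ E]
    {S : Set (WeakDual ℂ E)} (hS : Convex ℝ S) (hSc : IsClosed S) {x : WeakDual ℂ E}
    (hx : x ∉ S) : ∃ (a : E) (u : ℝ), (∀ y ∈ S, (y a).re < u) ∧ u < (x a).re := by
  have : IsScalarTower ℝ ℂ (WeakDual ℂ E) :=
    ⟨fun r c y => smul_assoc r c (WeakDual.toStrongDual y)⟩
  have hlc : LocallyConvexSpace ℝ (WeakDual ℂ E) :=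
    (WeakDual.withSeminorms ℂ E).toLocallyConvexSpace
  obtain ⟨f, u, hfu, huf⟩ := @RCLike.geometric_hahn_banach_closed_point ℂ (WeakDual ℂ E)
    _ _ inferInstance _ _ _ _ _ _ _ (by exact hlc) hS hSc hx
  obtain ⟨a, rfl⟩ := LinearMap.dualEmbedding_surjective (topDualPairing ℂ E) f
  exact ⟨a, u, hfu, huf⟩

/-- Convexity of the closure, for the weak* topology. -/
theorem convex_closure_weakDual {E : Type*} [NormedAddCommGroup E] [NormedSpace ℂ E]
    {S : Set (WeakDual ℂ E)} (hS : Convex ℝ S) : Convex ℝ (closure S) := by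
  intro x hx y hy a b ha hb hab
  let f : WeakDual ℂ E → WeakDual ℂ E → WeakDual ℂ E := fun x' y' => a • x' + b • y'
  have hf : Continuous (Function.uncurry f) :=
    WeakDual.continuous_of_continuous_eval fun v =>
      ((((WeakDual.eval_continuous v).comp continuous_fst).const_smul a).add
        (((WeakDual.eval_continuous v).comp continuous_snd).const_smul b))
  exact show f x y ∈ closure S from
    map_mem_closure₂ hf hx hy fun _ hx' _ hy' => hS hx' hy' ha hb hab

/-- **Jordan decomposition**: a hermitian functional of norm at most one is a convex combination of
a quasi-state and the negative of a quasi-state. -/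
theorem exists_quasiState_decomposition (φ : StrongDual ℂ A) (hφ : Bidual.dualStar φ = φ)
    (h1 : ‖φ‖ ≤ 1) :
    ∃ s t : ℝ, 0 ≤ s ∧ 0 ≤ t ∧ s + t = 1 ∧ ∃ ω₁ ∈ quasiStateSpace A, ∃ ω₂ ∈ quasiStateSpace A,
      ∀ a, φ a = s * ω₁ a - t * ω₂ a := by
  set Q := quasiStateSpace A
  set K : Set (WeakDual ℂ A) := convexHull ℝ (Q ∪ -Q) with hK
  have hQc : IsCompact Q := isCompact_quasiStateSpace
  have hne : Q.Nonempty := ⟨0, zero_mem_quasiStateSpace⟩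
  have hKeq : K = convexJoin ℝ Q (-Q) :=
    convex_quasiStateSpace.convexHull_union convex_quasiStateSpace.neg hne hne.neg
  -- A join of two compact convex sets is an image of `[0,1] × Q × -Q`, hence compact, so `K` can be
  -- separated from a point.
  have hKc : IsCompact K := by
    have hcont : Continuous fun p : ℝ × WeakDual ℂ A × WeakDual ℂ A =>
        (1 - p.1) • p.2.1 + p.1 • p.2.2 := by fun_prop
    convert (isCompact_Icc (a := (0 : ℝ)) (b := 1)).prod (hQc.prod hQc.neg) |>.image hcont using 1
    rw [hKeq]
    ext x
    rw [mem_convexJoin]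
    constructor
    · rintro ⟨y, hy, z, hz, hx⟩
      obtain ⟨s, t, hs, ht, hst, rfl⟩ := hx
      obtain rfl : s = 1 - t := by linarith
      exact ⟨(t, y, z), ⟨⟨ht, by linarith⟩, hy, hz⟩, rfl⟩
    · rintro ⟨⟨θ, y, z⟩, ⟨hθ, hy, hz⟩, rfl⟩
      exact ⟨y, hy, z, hz, 1 - θ, θ, sub_nonneg.mpr hθ.2, hθ.1, sub_add_cancel 1 θ, rfl⟩
  have hmem : StrongDual.toWeakDual φ ∈ K := by
    by_contra hnot
    obtain ⟨a, u, hfu', huf'⟩ :=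
      exists_re_lt_of_notMem_closed_convex (convex_convexHull ℝ (Q ∪ -Q)) hKc.isClosed hnot
    rw [StrongDual.toWeakDual_apply] at huf'
    -- Hermitian functionals satisfy `ψ h = 2 Re (ψ a)`. A quasi-state norming `h` gives `‖h‖ < 2u`,
    -- whereas `2u < φ h ≤ ‖h‖`.
    set h : A := a + star a
    have hh : IsSelfAdjoint h := IsSelfAdjoint.add_star_self a
    have hreal : ∀ ψ : A →L[ℂ] ℂ, ψ (star a) = star (ψ a) → ψ h = (2 * (ψ a).re : ℝ) :=
      fun ψ hψ => by
        rw [map_add, hψ]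
        exact Complex.add_conj _
    have hφh : φ h = (2 * (φ a).re : ℝ) := hreal φ (by
      conv_rhs => rw [← hφ]
      simp)
    obtain ⟨ω, hω, hωh⟩ := exists_quasiState_norm_apply_eq hh
    rw [show ω h = (2 * (ω a).re : ℝ) from hreal (WeakDual.toStrongDual ω)
      (map_star_of_positive (WeakDual.toStrongDual ω) hω.1 a),
      Complex.norm_real, Real.norm_eq_abs] at hωh
    have hu : ‖h‖ < 2 * u := by
      have hp : (ω a).re < u := hfu' ω (subset_convexHull ℝ _ (Or.inl hω))
      have hm : -(ω a).re < u :=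
        hfu' (-ω) (subset_convexHull ℝ _ (Or.inr (by simpa using hω)))
      rw [← hωh, abs_lt]
      constructor <;> linarith
    have hle : ‖φ h‖ ≤ ‖h‖ := (φ.le_opNorm h).trans (mul_le_of_le_one_left (norm_nonneg _) h1)
    rw [hφh, Complex.norm_real] at hle
    have := (Real.le_norm_self _).trans hle
    linarith
  rw [hKeq, mem_convexJoin] at hmem
  obtain ⟨x, hx, y, hy, s, t, hs, ht, hst, hxy⟩ := hmem
  refine ⟨s, t, hs, ht, hst, x, hx, -y, hy, fun a => ?_⟩
  have h : φ a = (s • x + t • y) a := by rw [hxy]; rfl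
  rw [h]
  change (s : ℂ) * x a + (t : ℂ) * y a = s * x a - t * (-(y a))
  ring

/-! ### Quasi-states determine the bidual -/

namespace Bidual

theorem dualStar_of_positive (ω : StrongDual ℂ A) (hω : ∀ a, 0 ≤ ω (star a * a)) :
    dualStar ω = ω := by
  ext a
  rw [dualStar_apply, map_star_of_positive ω hω, _root_.star_star]

/-- The norm of a hermitian element of the bidual is controlled by its values on quasi-states. -/
theorem norm_le_of_quasiState {K : Bidual A} (hK : star K = K) {c : ℝ}
    (hc : ∀ ω ∈ quasiStateSpace A, ‖toFunctional K (WeakDual.toStrongDual ω)‖ ≤ c) :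
    ‖K‖ ≤ c := by
  have hc0 : 0 ≤ c := (norm_nonneg _).trans (hc 0 zero_mem_quasiStateSpace)
  have hherm : ∀ ψ : StrongDual ℂ A, dualStar ψ = ψ → ‖ψ‖ ≤ 1 → ‖toFunctional K ψ‖ ≤ c := by
    intro ψ hψ h1
    obtain ⟨s, t, hs, ht, hst, ω₁, hω₁, ω₂, hω₂, hdec⟩ :=
      exists_quasiState_decomposition ψ hψ h1
    have hψ' : ψ = (s : ℂ) • WeakDual.toStrongDual ω₁ - (t : ℂ) • WeakDual.toStrongDual ω₂ := by
      ext a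
      exact hdec a
    rw [hψ', map_sub, map_smul, map_smul]
    refine (norm_sub_le _ _).trans ?_
    rw [norm_smul, norm_smul, Complex.norm_real, Complex.norm_real, Real.norm_of_nonneg hs,
      Real.norm_of_nonneg ht]
    calc _ ≤ s * c + t * c := by
          gcongr
          · exact hc ω₁ hω₁
          · exact hc ω₂ hω₂
      _ = c := by rw [← _root_.add_mul, hst, one_mul]
  rw [← norm_toFunctional]
  refine ContinuousLinearMap.opNorm_le_of_unit_norm hc0 fun φ hφ => ?_
  obtain ⟨z, hz, hzK⟩ : ∃ z : ℂ, ‖z‖ = 1 ∧ z * toFunctional K φ = ‖toFunctional K φ‖ := by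
    obtain ⟨z, hz, h⟩ := RCLike.exists_norm_eq_mul_self (toFunctional K φ)
    exact ⟨z, hz, h.symm⟩
  -- The hermitian part of `z • φ`: as `K` is hermitian and `K (z • φ)` is real, passing to it does
  -- not change the value of `K`.
  set ψ : StrongDual ℂ A := (2⁻¹ : ℂ) • (z • φ + dualStar (z • φ)) with hψ
  have hKψ : toFunctional K ψ = ‖toFunctional K φ‖ := by
    have h := star_apply K (z • φ)
    rw [hK, map_smul, smul_eq_mul, hzK] at h
    have h' : toFunctional K (dualStar (z • φ)) = ‖toFunctional K φ‖ := by
      rw [← _root_.star_star (toFunctional K (dualStar (z • φ))), ← h]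
      exact Complex.conj_ofReal _
    rw [hψ, map_smul, map_add, map_smul, smul_eq_mul, smul_eq_mul, hzK, h']
    ring
  have hzφ : ‖z • φ‖ ≤ 1 := by rw [norm_smul, hz, hφ, one_mul]
  have hψ1 : ‖ψ‖ ≤ 1 := by
    rw [hψ, norm_smul]
    calc ‖(2⁻¹ : ℂ)‖ * ‖z • φ + dualStar (z • φ)‖ ≤ 2⁻¹ * (1 + 1) := by
          refine mul_le_mul (by simp) ?_ (norm_nonneg _) (by norm_num)
          exact (norm_add_le _ _).trans (add_le_add hzφ ((norm_dualStar_le _).trans hzφ))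
      _ = 1 := by norm_num
  have hψs : dualStar ψ = ψ := by
    rw [hψ, map_smulₛₗ, map_add, dualStar_dualStar, add_comm]
    simp [Complex.conj_ofNat]
  have := hherm ψ hψs hψ1
  rwa [hKψ, Complex.norm_real, norm_norm] at this

theorem functional_sub (F G : Bidual A) (φ : StrongDual ℂ A) :
    toFunctional (F - G) φ = toFunctional F φ - toFunctional G φ :=
  rfl

/-- The norm bound applies to the hermitian elements `M + star M` and `i (M - star M)`, which also
vanish on quasi-states. -/
theorem eq_zero_of_quasiState {M : Bidual A}
    (hM : ∀ ω ∈ quasiStateSpace A, toFunctional M (WeakDual.toStrongDual ω) = 0) : M = 0 := by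
  have hM' : ∀ ω ∈ quasiStateSpace A, toFunctional (star M) (WeakDual.toStrongDual ω) = 0 :=
    fun ω hω => by
      rw [star_apply, dualStar_of_positive (WeakDual.toStrongDual ω) hω.1, hM ω hω, star_zero]
  have h1 : M + star M = 0 := by
    refine norm_le_zero_iff.mp (norm_le_of_quasiState ?_ fun ω hω => ?_)
    · rw [star_add, star_star, add_comm]
    · simp [hM ω hω, hM' ω hω, -star_apply]
  have h2 : Complex.I • (M - star M) = 0 := by
    refine norm_le_zero_iff.mp (norm_le_of_quasiState ?_ fun ω hω => ?_)
    · rw [sub_eq_add_neg, ← neg_one_smul ℂ (star M), star_smul, star_add, star_smul, star_star]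
      simp only [Complex.star_def, Complex.conj_I, map_neg, map_one]
      module
    · simp [functional_sub, hM ω hω, hM' ω hω, -star_apply]
  have h3 : M = star M := sub_eq_zero.mp ((smul_eq_zero.mp h2).resolve_left Complex.I_ne_zero)
  rw [← h3, ← two_smul ℂ] at h1
  exact (smul_eq_zero.mp h1).resolve_left two_ne_zero

/-- The Arens product is compatible with the involution. -/
theorem star_mul_eq (F G : Bidual A) : star F * G = star (star G * F) := by
  refine sub_eq_zero.mp (eq_zero_of_quasiState fun ω hω => ?_)
  rw [functional_sub, star_apply, dualStar_of_positive (WeakDual.toStrongDual ω) hω.1,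
    star_mul_conj_symm_of_positive (WeakDual.toStrongDual ω) hω.1, sub_self]

section Unit

variable {e : Bidual A} (he : ∀ F : Bidual A, F * e = F)
include he

theorem star_right_unit_mul (F : Bidual A) : star e * F = F := by
  rw [star_mul_eq, he, star_star]

theorem star_right_unit : star e = e := by
  rw [← he (star e), star_right_unit_mul he]

end Unit

/-! ### Positive functionals on the bidual -/

/-- The semi-inner product attached to a positive functional on the bidual. -/
@[reducible]
def positiveCore (Φ : StrongDual ℂ (Bidual A)) (hΦ : ∀ F, 0 ≤ Φ (star F * F)) :
    PreInnerProductSpace.Core ℂ (Bidual A) where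
  inner F G := Φ (star F * G)
  re_inner_nonneg F := (Complex.nonneg_iff.mp (hΦ F)).1
  add_left F G K := by rw [star_add, add_mul, map_add]
  smul_left F G c := by rw [star_smul, smul_mul, map_smul]; rfl
  conj_inner_symm F G := by
    -- Polarization: reality of the form at `F + G` and at `F + iG` gives the imaginary and real
    -- parts of conjugate symmetry.
    have im0 : ∀ K, (Φ (star K * K)).im = 0 := fun K => (Complex.nonneg_iff.mp (hΦ K)).2.symm
    have h1 := im0 (F + G)
    have h2 := im0 (F + Complex.I • G)
    simp only [star_add, star_smul, add_mul, mul_add, smul_mul, mul_smul, map_add, map_smul,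
      Complex.add_im, im0, smul_eq_mul, Complex.star_def, Complex.conj_I] at h1 h2
    simp only [Complex.mul_im, Complex.I_re, Complex.I_im, Complex.neg_re, Complex.neg_im,
      Complex.add_re, Complex.add_im, Complex.mul_re, Complex.mul_im, im0] at h2
    apply Complex.ext
    · rw [Complex.conj_re]
      linarith
    · rw [Complex.conj_im]
      linarith

theorem map_star_of_positive_bidual (Φ : StrongDual ℂ (Bidual A))
    (hΦ : ∀ F, 0 ≤ Φ (star F * F)) (F : Bidual A) : Φ (star F) = star (Φ F) := by
  obtain ⟨e, -, he⟩ := exists_right_unit A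
  have h := (positiveCore Φ hΦ).conj_inner_symm F e
  change star (Φ (star e * F)) = Φ (star F * e) at h
  rw [he, star_right_unit_mul he] at h
  exact h.symm

/-- A positive functional on the bidual attains its norm at the unit. -/
theorem apply_unit_eq_norm (Φ : StrongDual ℂ (Bidual A)) (hΦ : ∀ F, 0 ≤ Φ (star F * F))
    {e : Bidual A} (he1 : ‖e‖ ≤ 1) (he : ∀ F : Bidual A, F * e = F) : Φ e = ‖Φ‖ := by
  have hee : star e * e = e := by rw [he, star_right_unit he]
  have hpos : 0 ≤ Φ e := by simpa only [hee] using hΦ e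
  obtain ⟨hre, him⟩ := Complex.nonneg_iff.mp hpos
  -- Cauchy-Schwarz for the pair `F`, `e`.
  have hCS : ∀ F, ‖Φ F‖ ^ 2 ≤ ‖Φ‖ * ‖F‖ ^ 2 * (Φ e).re := fun F => by
    have h := @InnerProductSpace.Core.inner_mul_inner_self_le ℂ (Bidual A) _ _ _
      (positiveCore Φ hΦ) F e
    change ‖Φ (star F * e)‖ * ‖Φ (star e * F)‖ ≤ (Φ (star F * F)).re * (Φ (star e * e)).re at h
    rw [hee, he, star_right_unit_mul he, map_star_of_positive_bidual Φ hΦ, norm_star, ← sq] at h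
    refine h.trans (mul_le_mul_of_nonneg_right ?_ hre)
    refine (Complex.re_le_norm _).trans ((Φ.le_opNorm _).trans ?_)
    gcongr
    rw [sq]
    exact (norm_mul_le _ _).trans (by gcongr; exact norm_star_le F)
  have hle : ‖Φ‖ ≤ √(‖Φ‖ * (Φ e).re) :=
    Φ.opNorm_le_bound (Real.sqrt_nonneg _) fun F => by
      rw [← sq_le_sq₀ (norm_nonneg _) (by positivity), mul_pow, Real.sq_sqrt (by positivity)]
      linarith [hCS F]
  have hsq : ‖Φ‖ ^ 2 ≤ ‖Φ‖ * (Φ e).re :=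
    (pow_le_pow_left₀ (norm_nonneg _) hle 2).trans_eq (Real.sq_sqrt (by positivity))
  have hge : (Φ e).re ≤ ‖Φ‖ :=
    (Complex.re_le_norm _).trans ((Φ.le_opNorm e).trans (mul_le_of_le_one_right (norm_nonneg _) he1))
  have heq : (Φ e).re = ‖Φ‖ := by
    rcases eq_or_lt_of_le (norm_nonneg Φ) with h0 | h0
    · linarith
    · nlinarith
  apply Complex.ext
  · simpa using heq
  · simpa using him.symm

/-! ### Normal states -/

theorem norm_evalAt (ω : WeakDual ℂ A) :
    ‖WeakDual.toStrongDual (evalAt ω)‖ = ‖WeakDual.toStrongDual ω‖ :=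
  (NormedSpace.inclusionInDoubleDualLi ℂ (E := StrongDual ℂ A)).norm_map (WeakDual.toStrongDual ω)

/-- Makes the norm additive on positive functionals of `A`, so that states form a convex set even
when `A` has no unit. -/
theorem functional_unit_eq_norm {e : Bidual A} (he1 : ‖e‖ ≤ 1) (he : ∀ F : Bidual A, F * e = F)
    (ω : WeakDual ℂ A) (hω : ∀ a : A, 0 ≤ ω (star a * a)) :
    toFunctional e (WeakDual.toStrongDual ω) = ‖WeakDual.toStrongDual ω‖ := by
  rw [← norm_evalAt]
  exact apply_unit_eq_norm (WeakDual.toStrongDual (evalAt ω))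
    (star_mul_self_nonneg_of_positive (WeakDual.toStrongDual ω) hω) he1 he

theorem evalAt_mem_stateSpace {ω : WeakDual ℂ A} (hω : ω ∈ stateSpace A) :
    evalAt ω ∈ stateSpace (Bidual A) :=
  ⟨star_mul_self_nonneg_of_positive (WeakDual.toStrongDual ω) hω.1, by rw [norm_evalAt, hω.2]⟩

theorem incl_star_mul (a : A) : incl (star a * a) = star (incl a) * incl a :=
  ext_functional fun φ => by
    rw [mul_apply, star_apply]
    simp [incl]

/-- Evaluation is isometric, and positivity of a normal state restricts to `A` by testing on `incl
a`. -/
theorem image_evalAt_stateSpace : evalAt '' stateSpace A = normalStateSpace A := by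
  ext Φ
  constructor
  · rintro ⟨ω, hω, rfl⟩
    exact ⟨evalAt_mem_stateSpace hω, WeakDual.toStrongDual ω, fun _ => rfl⟩
  · rintro ⟨hΦ, φ, hφ⟩
    obtain rfl : evalAt (StrongDual.toWeakDual φ) = Φ := DFunLike.ext _ _ fun F => (hφ F).symm
    refine ⟨StrongDual.toWeakDual φ, ⟨fun a => ?_, ?_⟩, rfl⟩
    · have h := hΦ.1 (incl a)
      rwa [← incl_star_mul] at h
    · rw [← norm_evalAt, hΦ.2]

theorem convex_image_evalAt_stateSpace : Convex ℝ (evalAt '' stateSpace A) := by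
  obtain ⟨e, he1, he⟩ := exists_right_unit A
  rintro _ ⟨x, hx, rfl⟩ _ ⟨y, hy, rfl⟩ s t hs ht hst
  have hpos : ∀ a : A, 0 ≤ (s • x + t • y) (star a * a) := fun a => by
    have h : (s • x + t • y) (star a * a) = (s : ℂ) * x (star a * a) + t * y (star a * a) := rfl
    rw [h]
    exact add_nonneg (mul_nonneg (by exact_mod_cast hs) (hx.1 a))
      (mul_nonneg (by exact_mod_cast ht) (hy.1 a))
  refine ⟨s • x + t • y, ⟨hpos, ?_⟩, ?_⟩
  · have h := functional_unit_eq_norm he1 he _ hpos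
    have h' : toFunctional e (WeakDual.toStrongDual (s • x + t • y)) = ((s + t : ℝ) : ℂ) := by
      have hsplit : WeakDual.toStrongDual (s • x + t • y) =
          (s : ℂ) • WeakDual.toStrongDual x + (t : ℂ) • WeakDual.toStrongDual y := rfl
      rw [hsplit, map_add, map_smul, map_smul, functional_unit_eq_norm he1 he x hx.1,
        functional_unit_eq_norm he1 he y hy.1, hx.2, hy.2]
      simp
    rw [h', hst] at h
    exact_mod_cast h.symm
  · refine DFunLike.ext _ _ fun F => ?_
    have hsplit : WeakDual.toStrongDual (s • x + t • y) =
        (s : ℂ) • WeakDual.toStrongDual x + (t : ℂ) • WeakDual.toStrongDual y := rfl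
    rw [evalAt_apply, hsplit, map_add, map_smul, map_smul]
    rfl

/-! ### Density -/

/-- A real bound for an element of the bidual on the states of `A` holds on all states of the
bidual. -/
theorem re_apply_le_of_forall_state {F : Bidual A} {u : ℝ}
    (hF : ∀ ω ∈ stateSpace A, (toFunctional F (WeakDual.toStrongDual ω)).re ≤ u)
    {Φ : WeakDual ℂ (Bidual A)} (hΦ : Φ ∈ stateSpace (Bidual A)) : (Φ F).re ≤ u := by
  obtain ⟨e, he1, he⟩ := exists_right_unit A
  -- Small enough that `s‖F‖ ≤ 1`, making `K` nonnegative on quasi-states, and `s|u| ≤ 1`, making `1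
  -- + s u` nonnegative.
  set s : ℝ := (‖F‖ + |u| + 1)⁻¹ with hs
  have hden : 0 < ‖F‖ + |u| + 1 := by positivity
  have hspos : 0 < s := by positivity
  have hsF : s * ‖F‖ ≤ 1 := by
    rw [hs, inv_mul_le_one₀ hden]
    linarith [abs_nonneg u]
  have hsu : s * |u| ≤ 1 := by
    rw [hs, inv_mul_le_one₀ hden]
    linarith [norm_nonneg F]
  have hsu' : 0 ≤ 1 + s * u := by nlinarith [neg_abs_le u]
  set K : Bidual A := e + ((s / 2 : ℝ) : ℂ) • (F + star F) with hK
  have hKstar : star K = K := by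
    rw [hK, star_add, star_smul, star_add, star_star, star_right_unit he, add_comm (star F)]
    simp
  have hnorm : ‖K‖ ≤ 1 + s * u := by
    refine norm_le_of_quasiState hKstar fun ω hω => ?_
    set r := ‖WeakDual.toStrongDual ω‖ with hr
    set x := (toFunctional F (WeakDual.toStrongDual ω)).re with hx
    have hval : toFunctional K (WeakDual.toStrongDual ω) = ((r + s * x : ℝ) : ℂ) := by
      have hFs : toFunctional F (WeakDual.toStrongDual ω) +
          toFunctional (star F) (WeakDual.toStrongDual ω) = ((2 * x : ℝ) : ℂ) := by
        rw [star_apply, dualStar_of_positive (WeakDual.toStrongDual ω) hω.1]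
        exact Complex.add_conj _
      rw [hK, map_add, map_smul, map_add, add_apply,
        smul_apply, add_apply, hFs,
        functional_unit_eq_norm he1 he ω hω.1, smul_eq_mul]
      push_cast
      ring
    have hr0 : 0 ≤ r := norm_nonneg _
    -- Rescale a nonzero quasi-state to a state, where the hypothesis applies.
    have hxr : x ≤ u * r := by
      rcases hr0.eq_or_lt with h0 | h0
      · have : WeakDual.toStrongDual ω = 0 := norm_eq_zero.mp h0.symm
        rw [hx, this, ← h0]
        simp
      · have hst : r⁻¹ • ω ∈ stateSpace A := by
          refine ⟨fun a => ?_, ?_⟩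
          · have h : (r⁻¹ • ω) (star a * a) = ((r⁻¹ : ℝ) : ℂ) * ω (star a * a) := rfl
            rw [h]
            exact mul_nonneg (by exact_mod_cast (inv_pos.mpr h0).le) (hω.1 a)
          · have h : WeakDual.toStrongDual (r⁻¹ • ω) =
                ((r⁻¹ : ℝ) : ℂ) • WeakDual.toStrongDual ω := rfl
            rw [h, norm_smul, Complex.norm_real, Real.norm_of_nonneg (inv_pos.mpr h0).le, ← hr,
              inv_mul_cancel₀ h0.ne']
        have h := hF _ hst
        have hsm : WeakDual.toStrongDual (r⁻¹ • ω) =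
            ((r⁻¹ : ℝ) : ℂ) • WeakDual.toStrongDual ω := rfl
        rw [hsm, map_smul, smul_eq_mul, Complex.re_ofReal_mul, ← hx, inv_mul_le_iff₀ h0] at h
        linarith
    have hxF : -(‖F‖ * r) ≤ x := by
      have h := (Complex.abs_re_le_norm _).trans
        ((toFunctional F).le_opNorm (WeakDual.toStrongDual ω))
      rw [norm_toFunctional, ← hx, ← hr] at h
      exact (abs_le.mp h).1
    have hlow : 0 ≤ r + s * x := by nlinarith
    rw [hval, Complex.norm_real, Real.norm_of_nonneg hlow]
    calc r + s * x ≤ r + s * (u * r) := by gcongr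
      _ = r * (1 + s * u) := by ring
      _ ≤ 1 * (1 + s * u) := by gcongr; exact hω.2
      _ = _ := one_mul _
  set Ψ : StrongDual ℂ (Bidual A) := WeakDual.toStrongDual Φ with hΨ
  have hΨpos : ∀ F, 0 ≤ Ψ (star F * F) := hΦ.1
  have hΨK : Ψ K = ((1 + s * (Φ F).re : ℝ) : ℂ) := by
    have hFs : Ψ F + star (Ψ F) = ((2 * (Ψ F).re : ℝ) : ℂ) := Complex.add_conj _
    rw [hK, map_add, map_smul, map_add, map_star_of_positive_bidual Ψ hΨpos, hFs,
      apply_unit_eq_norm Ψ hΨpos he1 he, hΦ.2, smul_eq_mul, hΨ, WeakDual.toStrongDual_apply]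
    push_cast
    ring
  have hb : ‖Ψ K‖ ≤ 1 + s * u := by
    refine (Ψ.le_opNorm K).trans ?_
    rw [hΦ.2, one_mul]
    exact hnorm
  rw [hΨK, Complex.norm_real] at hb
  have := (Real.le_norm_self _).trans hb
  exact le_of_mul_le_mul_left (by linarith) hspos

end Bidual

end

theorem corollary5 (A : Type*) [NonUnitalCStarAlgebra A] :
    Bidual.evalAt '' stateSpace A = normalStateSpace A ∧
      Dense {Φ : stateSpace (Bidual A) | (Φ : WeakDual ℂ (Bidual A)) ∈
        Bidual.evalAt '' stateSpace A} := by
  refine ⟨Bidual.image_evalAt_stateSpace, Subtype.dense_iff.mpr fun Φ hΦ => ?_⟩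
  have himg : ((↑) : stateSpace (Bidual A) → WeakDual ℂ (Bidual A)) ''
      {Φ | (Φ : WeakDual ℂ (Bidual A)) ∈ Bidual.evalAt '' stateSpace A} =
        Bidual.evalAt '' stateSpace A := by
    refine Subtype.coe_image_of_subset ?_
    rintro _ ⟨ω, hω, rfl⟩
    exact Bidual.evalAt_mem_stateSpace hω
  rw [himg]
  -- A weak* continuous separating functional is evaluation at some `F` in the bidual, which
  -- contradicts the transfer of the bound.
  by_contra hnot
  obtain ⟨F, u, hF, hu⟩ := exists_re_lt_of_notMem_closed_convex
    (convex_closure_weakDual Bidual.convex_image_evalAt_stateSpace) isClosed_closure hnot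
  exact hu.not_ge (Bidual.re_apply_le_of_forall_state
    (fun ω hω => (hF _ (subset_closure ⟨ω, hω, rfl⟩)).le) hΦ)
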